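/- Lemma (fast implementation of Haar-random columns). Fix an integer $D\ge 1$ and a real number $\alpha\ge 0$. Consider $m=L^D$ bosonic modes with operators $a_1,\dots,a_m$, placed in any order on the $m$ sites of the cubic lattice $\{0,\dots,L-1\}^D$, and let $d(i,j)$ be the Euclidean distance between the sites of the modes $i$ and $j$. In the power-law model of free bosons the allowed Hamiltonians are $$H(t)=\sum_{i}J_{ii}(t)\,a_i^\dagger a_i+\sum_{i<j}\bigl(J_{ij}(t)\,a_i^\dagger a_j+\mathrm{h.c.}\bigr),$$ with $J_{ij}(t)\in\mathbb C$, $|J_{ij}(t)|\le d(i,j)^{-\alpha}$ for $i\ne j$, and real on-site terms $J_{ii}(t)$ of arbitrary size, where the $J_{ij}$ are continuous in $t$ up to finitely many times. For a unitary $m\times m$ matrix $U$, the $j$-th column of $U$ can be implemented in time at most $\tau$ if there are $T\in[0,\tau]$ and an allowed $H(t)$, $0\le t\le T$, such that the solution of the Schrödinger equation $i\,\partial_t\psi=H(t)\psi$ with $\psi(0)=a_j^\dagger|\mathrm{vac}\rangle$ has $\psi(T)=\sum_{i=1}^m U_{ij}\,a_i^\dagger|\mathrm{vac}\rangle$. For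 every $k\in\mathbb N$ there are a constant $C>0$ and an integer $m_0$, depending only on $D$, $\alpha$ and $k$, such that for all $m=L^D\ge m_0$, every placement of the modes and every $n\le m$ the following holds. If $U$ is drawn from the normalized Haar measure on $U(m)$, then with probability at least $1-m^{-k}$ each of the first $n$ columns of $U$ can be implemented in time at most $$C\,\frac{\sqrt{\log m}}{m^{1/2-\alpha/D}}.$$ -/

import Mathlib

namespace PowerLawBosons

/-! ### The Haar measure on the unitary group -/

noncomputable instance unitaryMeasurableSpace (m : ℕ) : MeasurableSpace (Matrix.unitaryGroup (Fin m) ℂ) :=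
  borel _

instance unitaryBorelSpace (m : ℕ) : BorelSpace (Matrix.unitaryGroup (Fin m) ℂ) := ⟨rfl⟩

instance unitaryCompactSpace (m : ℕ) : CompactSpace (Matrix.unitaryGroup (Fin m) ℂ) := by
  have hbox : IsCompact
      (Set.pi Set.univ fun _ : Fin m => Set.pi Set.univ fun _ : Fin m =>
        Metric.closedBall (0 : ℂ) 1) :=
    isCompact_univ_pi fun _ => isCompact_univ_pi fun _ => isCompact_closedBall _ _
  have hclosed : IsClosed
      ((Matrix.unitaryGroup (Fin m) ℂ : Set (Matrix (Fin m) (Fin m) ℂ))) := by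
    have h : (Matrix.unitaryGroup (Fin m) ℂ : Set (Matrix (Fin m) (Fin m) ℂ))
        = {A | A * star A = 1} := by
      ext A
      exact Matrix.mem_unitaryGroup_iff
    rw [h]
    exact isClosed_eq (continuous_id.mul continuous_star) continuous_const
  refine isCompact_iff_compactSpace.mp (hbox.of_isClosed_subset hclosed ?_)
  intro A hA i _ j _
  simpa using entry_norm_bound_of_unitary hA i j

/-- The Haar measure on `U(m)`, normalized to total mass one. -/
noncomputable def haarUnitary (m : ℕ) : MeasureTheory.Measure (Matrix.unitaryGroup (Fin m) ℂ) :=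
  MeasureTheory.Measure.haarMeasure ⊤

instance haarUnitary_isHaarMeasure (m : ℕ) :
    MeasureTheory.Measure.IsHaarMeasure (haarUnitary m) := by
  unfold haarUnitary
  infer_instance

instance haarUnitary_isProbabilityMeasure (m : ℕ) :
    MeasureTheory.IsProbabilityMeasure (haarUnitary m) := by
  constructor
  have h := MeasureTheory.Measure.haarMeasure_self
    (K₀ := (⊤ : TopologicalSpace.PositiveCompacts (Matrix.unitaryGroup (Fin m) ℂ)))
  rwa [TopologicalSpace.PositiveCompacts.coe_top] at h

/-! ### The cubic lattice -/

/-- The sites of the `D`-dimensional cubic lattice of side `L`; there are `L ^ D` of them. -/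
abbrev Site (D L : ℕ) : Type := Fin D → Fin L

/-- The Euclidean distance between two lattice sites; nearest neighbours have distance one. -/
noncomputable def siteDist {D L : ℕ} (x y : Site D L) : ℝ :=
  √(∑ k, (((x k : ℕ) : ℝ) - ((y k : ℕ) : ℝ)) ^ 2)

/-! ### Bosons on `m` modes -/

/-- The algebraic Fock space of `m` bosonic modes: the monomial `∏ i, X i ^ s i` is the
(unnormalized) vector `∏ i, (a_i†) ^ s i |vac⟩`, and `1` is the vacuum. -/
abbrev Fock (m : ℕ) : Type := MvPolynomial (Fin m) ℂ

/-- The creation operator `a_i†`. -/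
noncomputable def creation {m : ℕ} (i : Fin m) : Fock m →ₗ[ℂ] Fock m :=
  LinearMap.mulLeft ℂ (MvPolynomial.X i)

/-- The annihilation operator `a_i`, determined by `[a_i, a_j†] = δ_ij` and `a_i |vac⟩ = 0`. -/
noncomputable def annihilation {m : ℕ} (i : Fin m) : Fock m →ₗ[ℂ] Fock m :=
  (MvPolynomial.pderiv i).toLinearMap

/-- The free-boson Hamiltonian `∑ i j, J_ij a_i† a_j`. For Hermitian `J` this is
`∑ i, J_ii a_i† a_i + ∑ i < j, (J_ij a_i† a_j + h.c.)`. -/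
noncomputable def hoppingHamiltonian {m : ℕ} (J : Matrix (Fin m) (Fin m) ℂ) :
    Fock m →ₗ[ℂ] Fock m :=
  ∑ i, ∑ j, J i j • (creation i ∘ₗ annihilation j)

/-- The couplings `J` are allowed in the power-law model with exponent `α`, mode `i` being placed
at the lattice site `e i`: the hopping between distinct sites is bounded by the inverse `α`-th
power of their distance, and the on-site terms are not bounded. -/
def IsPowerLaw {D L m : ℕ} (α : ℝ) (e : Fin m ≃ Site D L) (J : Matrix (Fin m) (Fin m) ℂ) : Prop :=
  J.IsHermitian ∧ ∀ i j, i ≠ j → ‖J i j‖ ≤ 1 / siteDist (e i) (e j) ^ α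

/-- `ψ` solves the Schrödinger equation `i ∂_t ψ = H(t) ψ` on `[0, T]` for the time-dependent
couplings `J`, which are continuous up to finitely many switching times; `ψ` itself is continuous
throughout. Derivatives and continuity are understood coefficient by coefficient. -/
def SolvesSchrodinger {m : ℕ} (T : ℝ) (J : ℝ → Matrix (Fin m) (Fin m) ℂ) (ψ : ℝ → Fock m) :
    Prop :=
  (∀ s, ContinuousOn (fun t => (ψ t).coeff s) (Set.Icc 0 T)) ∧
  ∃ F : Set ℝ, F.Finite ∧ ∀ t ∈ Set.Ioo 0 T \ F,
    ContinuousAt J t ∧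
    ∀ s, HasDerivAt (fun τ => (ψ τ).coeff s)
      (-Complex.I * (hoppingHamiltonian (J t) (ψ t)).coeff s) t

/-- The column `j` of `U` can be implemented in time at most `τ`: some allowed choice of
time-dependent couplings maps the state `a_j† |vac⟩` to `∑ i, U_ij a_i† |vac⟩` in a time
`T ≤ τ`. -/
def ColumnImplementableWithin {D L m : ℕ} (α : ℝ) (e : Fin m ≃ Site D L)
    (U : Matrix (Fin m) (Fin m) ℂ) (j : Fin m) (τ : ℝ) : Prop :=
  ∃ T : ℝ, 0 ≤ T ∧ T ≤ τ ∧
    ∃ (J : ℝ → Matrix (Fin m) (Fin m) ℂ) (ψ : ℝ → Fock m),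
      (∀ t ∈ Set.Icc 0 T, IsPowerLaw α e (J t)) ∧
      SolvesSchrodinger T J ψ ∧
      ψ 0 = creation j 1 ∧
      ψ T = ∑ i, U i j • creation i 1

end PowerLawBosons

/-! ### Implementing a flat column with a star Hamiltonian -/

namespace PowerLawBosons

section

open Complex

/-! A constant star Hamiltonian centred at `j` rotates `e_j` straight to the target column, with all
hops acting in parallel. If the entries are at most `δ` in modulus and every pair may hop with
strength `1 / G`, time of order `δ * G` suffices (`columnImplementableWithin_of_norm_le`). The
lattice diameter gives `G` of order `m ^ (α / D)` (`one_div_le_one_div_siteDist_rpow`).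

Haar-random entries have `δ` of order `√(log m / m)`. By left invariance, an entry is distributed
like a column averaged with signs `± 1 / √m`. Since columns are unit vectors, averaging over the
signs gives a sub-Gaussian bound (`integral_exp_entry_le`), and a union bound covers all entries. -/

lemma hoppingHamiltonian_singleParticle {m : ℕ} (J : Matrix (Fin m) (Fin m) ℂ) (c : Fin m → ℂ) :
    hoppingHamiltonian J (∑ i, c i • creation i 1) =
      ∑ i, (J.mulVec c) i • (creation i 1 : Fock m) := by
  have h : ∀ j l : Fin m, annihilation j (creation l (1 : Fock m)) = if l = j then 1 else 0 := by
    intro j l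
    simp [annihilation, creation, MvPolynomial.pderiv_X, Pi.single_apply]
  simp only [hoppingHamiltonian, LinearMap.sum_apply, LinearMap.smul_apply, LinearMap.comp_apply,
    map_sum, map_smul, h, Matrix.mulVec, dotProduct, Finset.sum_smul, Finset.smul_sum]
  rw [Finset.sum_comm]
  refine Finset.sum_congr rfl fun i _ => ?_
  rw [Finset.sum_comm]
  refine Finset.sum_congr rfl fun j _ => ?_
  rw [Finset.sum_eq_single j (fun l _ hl => by rw [if_neg hl]; simp) (by simp)]
  simp [smul_smul, mul_comm]

/-- Single-particle amplitudes solving the one-body Schrödinger equation solve the many-body one. -/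
lemma solvesSchrodinger_singleParticle {m : ℕ} (T : ℝ) (J : Matrix (Fin m) (Fin m) ℂ)
    (c : ℝ → Fin m → ℂ)
    (hc : ∀ t i, HasDerivAt (fun τ => c τ i) (-I * (J.mulVec (c t)) i) t) :
    SolvesSchrodinger T (fun _ => J) (fun t => ∑ i, c t i • creation i 1) := by
  have key : ∀ t s, HasDerivAt
      (fun τ => (∑ i, c τ i • (creation i 1 : Fock m)).coeff s)
      (-I * (hoppingHamiltonian J (∑ i, c t i • creation i 1)).coeff s) t := by
    intro t s
    rw [hoppingHamiltonian_singleParticle]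
    simp only [MvPolynomial.coeff_sum, MvPolynomial.coeff_smul, smul_eq_mul, Finset.mul_sum,
      ← mul_assoc]
    exact HasDerivAt.fun_sum fun i _ => (hc t i).mul_const _
  exact ⟨fun s t _ => (key t s).continuousAt.continuousWithinAt, ∅, Set.finite_empty,
    fun t _ => ⟨continuousAt_const, key t⟩⟩

/-- The couplings of a star centred at `j` with weights `ω u`, shifted by `μ` on every site. -/
noncomputable def starCoupling {m : ℕ} (j : Fin m) (μ ω : ℝ) (u : Fin m → ℂ) :
    Matrix (Fin m) (Fin m) ℂ :=
  fun i l => (if i = l then (μ : ℂ) else 0) +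
    ω * (u i * (if l = j then 1 else 0) + (if i = j then 1 else 0) * star (u l))

/-- The rotation of `e_j` towards `-i u` generated by `starCoupling`. -/
noncomputable def starAmplitude {m : ℕ} (j : Fin m) (μ ω : ℝ) (u : Fin m → ℂ) (t : ℝ) :
    Fin m → ℂ :=
  fun i => exp (-I * μ * t) *
    (cos (ω * t) * (if i = j then 1 else 0) - I * sin (ω * t) * u i)

lemma starCoupling_isHermitian {m : ℕ} (j : Fin m) (μ ω : ℝ) (u : Fin m → ℂ) :
    (starCoupling j μ ω u).IsHermitian := by
  ext i l
  simp only [Matrix.conjTranspose_apply, starCoupling, star_add, star_mul', apply_ite star,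
    star_zero, star_one, RCLike.star_def, conj_ofReal, conj_conj, eq_comm (a := l) (b := i)]
  ring

/-- As `u` is a unit vector orthogonal to `e_j`, the star swaps `e_j` and `u` up to the factor `ω`,
so the dynamics stays in their span. -/
lemma starCoupling_mulVec {m : ℕ} (j : Fin m) (μ ω : ℝ) (u : Fin m → ℂ) (huj : u j = 0)
    (hu : ∑ i, star (u i) * u i = 1) (t : ℝ) (i : Fin m) :
    (starCoupling j μ ω u).mulVec (starAmplitude j μ ω u t) i =
      μ * starAmplitude j μ ω u t i + exp (-I * μ * t) * (ω * (cos (ω * t) * u i -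
        I * sin (ω * t) * (if i = j then 1 else 0))) := by
  have h1 : ∑ l, star (u l) * starAmplitude j μ ω u t l =
      exp (-I * μ * t) * (-I * sin (ω * t)) := by
    calc _ = ∑ l : Fin m, (exp (-I * μ * t) * cos (ω * t) * (if l = j then star (u l) else 0) +
          exp (-I * μ * t) * (-I * sin (ω * t)) * (star (u l) * u l)) := by
          refine Finset.sum_congr rfl fun l _ => ?_
          simp only [starAmplitude]
          split_ifs <;> ring
      _ = _ := by
          rw [Finset.sum_add_distrib, ← Finset.mul_sum, ← Finset.mul_sum, hu]
          simp [huj]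
  have h2 : starAmplitude j μ ω u t j = exp (-I * μ * t) * cos (ω * t) := by
    simp [starAmplitude, huj]
  calc _ = ∑ l : Fin m, ((if i = l then (μ : ℂ) * starAmplitude j μ ω u t l else 0) +
        ((if l = j then ω * u i * starAmplitude j μ ω u t l else 0) +
        ω * (if i = j then 1 else 0) * (star (u l) * starAmplitude j μ ω u t l))) := by
        rw [Matrix.mulVec, dotProduct]
        refine Finset.sum_congr rfl fun l _ => ?_
        simp only [starCoupling]
        split_ifs <;> ring
    _ = _ := by
        rw [Finset.sum_add_distrib, Finset.sum_add_distrib, ← Finset.mul_sum, h1]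
        simp only [Finset.sum_ite_eq, Finset.sum_ite_eq', Finset.mem_univ, if_true, h2]
        ring

lemma hasDerivAt_starAmplitude {m : ℕ} (j : Fin m) (μ ω : ℝ) (u : Fin m → ℂ) (huj : u j = 0)
    (hu : ∑ i, star (u i) * u i = 1) (t : ℝ) (i : Fin m) :
    HasDerivAt (fun τ => starAmplitude j μ ω u τ i)
      (-I * (starCoupling j μ ω u).mulVec (starAmplitude j μ ω u t) i) t := by
  have hid : HasDerivAt (fun z : ℂ => z) 1 (t : ℂ) := hasDerivAt_id _
  have he := (hid.const_mul (-I * μ)).cexp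
  have hw := hid.const_mul (ω : ℂ)
  have hsub := (hw.ccos.mul_const (if i = j then (1 : ℂ) else 0)).sub
    ((hw.csin.const_mul I).mul_const (u i))
  refine ((he.mul hsub).comp_ofReal).congr_deriv ?_
  rw [starCoupling_mulVec j μ ω u huj hu]
  simp only [starAmplitude, Pi.sub_apply]
  ring_nf
  simp only [I_sq]
  ring

/-- A column with entries of modulus at most `δ ≤ 1 / 2` is implemented in time `π δ G`, where
`G` bounds the inverse hopping strengths. -/
lemma columnImplementableWithin_of_norm_le {D L m : ℕ} {α : ℝ} (e : Fin m ≃ Site D L)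
    (U : Matrix (Fin m) (Fin m) ℂ) (j : Fin m) {δ G : ℝ} (hδ : 0 < δ) (hδ' : δ ≤ 1 / 2)
    (hG : 0 < G) (hdist : ∀ i l, i ≠ l → 1 / G ≤ 1 / siteDist (e i) (e l) ^ α)
    (hunit : ∑ i, ‖U i j‖ ^ 2 = 1) (hU : ∀ i, ‖U i j‖ ≤ δ) :
    ColumnImplementableWithin α e U j (Real.pi * δ * G) := by
  set a : ℝ := ‖U j j‖ with ha
  set θ : ℝ := Real.arccos a with hθ
  set r : ℝ := √(1 - a ^ 2) with hr
  have ha0 : 0 ≤ a := norm_nonneg _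
  have ha1 : a ≤ 1 / 2 := (hU j).trans hδ'
  have hsin : Real.sin θ = r := Real.sin_arccos a
  have hcos : Real.cos θ = a := Real.cos_arccos (by linarith) (by linarith)
  have hr2 : r ^ 2 = 1 - a ^ 2 := Real.sq_sqrt (by nlinarith)
  -- A small diagonal entry keeps `r` away from zero, so dividing by `r` costs at most a factor of
  -- two in time.
  have hr1 : 1 / 2 ≤ r := Real.le_sqrt_of_sq_le (by nlinarith)
  have hr0 : 0 < r := by linarith
  have hθ0 : 0 < θ := Real.arccos_pos.2 (by linarith)
  have hθ1 : θ ≤ Real.pi / 2 := Real.arccos_le_pi_div_two.2 ha0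
  set φ : ℝ := (U j j).arg
  -- The prefactor cancels the `-I` of the rotation and the global phase `exp (I * φ)` that the
  -- on-site shift produces at time `T`.
  set u : Fin m → ℂ := fun i => if i = j then 0 else I * exp (-(I * φ)) * U i j / r with hudef
  -- Chosen so that `‖u i‖ ≤ δ / r` gives `ω * ‖u i‖ ≤ 1 / G`.
  set ω : ℝ := r / (δ * G) with hω
  have hω0 : 0 < ω := by positivity
  set T : ℝ := θ / ω with hT
  have hT0 : 0 < T := by positivity
  -- On-site terms are unbounded, so the phase of `U j j` takes no extra time.
  set μ : ℝ := -φ / T with hμ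
  have hωT : ω * T = θ := by rw [hT]; field_simp
  have hμT : μ * T = -φ := by rw [hμ]; field_simp
  have huj : u j = 0 := by simp [hudef]
  have hexp : ‖exp (-(I * φ))‖ = 1 := by
    rw [show -(I * (φ : ℂ)) = ((-φ : ℝ) : ℂ) * I by push_cast; ring, norm_exp_ofReal_mul_I]
  have hnorm : ∀ i, i ≠ j → ‖u i‖ = ‖U i j‖ / r := by
    intro i hi
    simp [hudef, hi, hexp, abs_of_pos hr0]
  have hu : ∑ i, star (u i) * u i = 1 := by
    have h1 : ∀ i, star (u i) * u i = ((‖u i‖ ^ 2 : ℝ) : ℂ) := fun i => by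
      rw [RCLike.star_def, conj_mul']; push_cast; rfl
    simp only [h1]
    rw [← ofReal_sum, ← Finset.add_sum_erase _ _ (Finset.mem_univ j), huj,
      Finset.sum_congr rfl fun i hi => by rw [hnorm i (Finset.ne_of_mem_erase hi), div_pow],
      ← Finset.sum_div]
    rw [← Finset.add_sum_erase _ _ (Finset.mem_univ j)] at hunit
    rw [show ∑ i ∈ Finset.univ.erase j, ‖U i j‖ ^ 2 = r ^ 2 by rw [hr2]; linarith]
    have : r ^ 2 ≠ 0 := by positivity
    simp [this]
  have hule : ∀ i, ω * ‖u i‖ ≤ 1 / G := by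
    intro i
    by_cases hi : i = j
    · rw [hi, huj]; simp; positivity
    · rw [hnorm i hi, hω]
      calc r / (δ * G) * (‖U i j‖ / r) = ‖U i j‖ / δ * (1 / G) := by field_simp
        _ ≤ 1 * (1 / G) := by
          gcongr
          exact (div_le_one hδ).2 (hU i)
        _ = _ := one_mul _
  refine ⟨T, hT0.le, ?_, fun _ => starCoupling j μ ω u,
    fun t => ∑ i, starAmplitude j μ ω u t i • creation i 1, ?_,
    solvesSchrodinger_singleParticle T _ _ (hasDerivAt_starAmplitude j μ ω u huj hu), ?_, ?_⟩
  · calc T = θ * (δ * G) / r := by rw [hT, hω]; field_simp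
      _ ≤ Real.pi / 2 * (δ * G) / (1 / 2) := by gcongr
      _ = _ := by ring
  · refine fun _ _ => ⟨starCoupling_isHermitian j μ ω u, fun i l hil => ?_⟩
    refine le_trans ?_ (hdist i l hil)
    simp only [starCoupling, if_neg hil, zero_add, norm_mul, norm_real, Real.norm_eq_abs,
      abs_of_pos hω0]
    by_cases hl : l = j
    · subst hl
      simpa [hil] using hule i
    · by_cases hi : i = j
      · subst hi
        simpa [hl] using hule l
      · simp [hi, hl]; positivity
  · simp [starAmplitude]
  · refine Finset.sum_congr rfl fun i _ => ?_
    congr 1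
    have e1 : -I * (μ : ℂ) * T = φ * I := by
      rw [show -I * (μ : ℂ) * T = -I * ((μ * T : ℝ) : ℂ) by push_cast; ring, hμT]
      push_cast; ring
    simp only [starAmplitude, e1, ← ofReal_mul, hωT]
    rw [← ofReal_cos, ← ofReal_sin, hcos, hsin]
    by_cases hi : i = j
    · subst hi
      simp only [huj, if_true]
      have := norm_mul_exp_arg_mul_I (U i i)
      rw [← this]
      ring
    · have hrc : (r : ℂ) ≠ 0 := by exact_mod_cast hr0.ne'
      have e2 : exp (φ * I) * exp (-(I * φ)) = 1 := by
        rw [← exp_add]; simp [mul_comm]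
      simp only [hudef, if_neg hi]
      calc _ = -(I ^ 2) * (exp (φ * I) * exp (-(I * φ))) * U i j * (r / r) := by ring
        _ = U i j := by rw [e2, I_sq, div_self hrc]; ring

lemma siteDist_pos {D L : ℕ} {x y : Site D L} (h : x ≠ y) : 0 < siteDist x y := by
  obtain ⟨k, hk⟩ := Function.ne_iff.1 h
  refine Real.sqrt_pos.2 (Finset.sum_pos' (fun _ _ => sq_nonneg _) ⟨k, Finset.mem_univ _, ?_⟩)
  have : ((x k : ℕ) : ℝ) - ((y k : ℕ) : ℝ) ≠ 0 := by
    rw [sub_ne_zero]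
    exact fun h => hk (Fin.ext (by exact_mod_cast h))
  positivity

lemma siteDist_le {D L : ℕ} (x y : Site D L) : siteDist x y ≤ √(D : ℝ) * L := by
  refine Real.sqrt_le_iff.2 ⟨by positivity, ?_⟩
  rw [mul_pow, Real.sq_sqrt (by positivity)]
  calc _ ≤ ∑ _k : Fin D, (L : ℝ) ^ 2 := by
        refine Finset.sum_le_sum fun k _ => sq_le_sq' ?_ ?_
        · have : ((y k : ℕ) : ℝ) ≤ L := by exact_mod_cast (y k).2.le
          have : (0 : ℝ) ≤ ((x k : ℕ) : ℝ) := by positivity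
          linarith
        · have : ((x k : ℕ) : ℝ) ≤ L := by exact_mod_cast (x k).2.le
          have : (0 : ℝ) ≤ ((y k : ℕ) : ℝ) := by positivity
          linarith
    _ = _ := by simp

end

end PowerLawBosons

/-! ### Sub-Gaussian entries of Haar-random unitaries -/

namespace PowerLawBosons

section

open MeasureTheory

lemma exists_unitary_row_eq {m : ℕ} (i : Fin m) (x : Fin m → ℂ) (hx : ∑ l, ‖x l‖ ^ 2 = 1) :
    ∃ W : Matrix.unitaryGroup (Fin m) ℂ, ∀ l, (W : Matrix (Fin m) (Fin m) ℂ) i l = x l := by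
  -- Basis vectors are columns; the adjoint taken below turns them into conjugated rows, hence the
  -- `star` here.
  set y : EuclideanSpace ℂ (Fin m) := WithLp.toLp 2 (star x) with hy
  have hy1 : ‖y‖ = 1 := by
    rw [EuclideanSpace.norm_eq, hy]
    simp [hx]
  have hv : Orthonormal ℂ (({i} : Set (Fin m)).domRestrict fun _ => y) := by
    rw [orthonormal_iff_ite]
    rintro ⟨a, rfl⟩ ⟨b, rfl⟩
    simp [inner_self_eq_norm_sq_to_K, hy1]
  obtain ⟨b, hb⟩ := hv.exists_orthonormalBasis_extension_of_card_eq (by simp)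
  refine ⟨star ⟨_, (EuclideanSpace.basisFun (Fin m) ℂ).toMatrix_orthonormalBasis_mem_unitary b⟩,
    fun l => ?_⟩
  have : b i = y := hb i rfl
  simp [Matrix.star_apply, Module.Basis.toMatrix_apply, this, hy]

lemma sum_norm_sq_column {m : ℕ} (U : Matrix.unitaryGroup (Fin m) ℂ) (j : Fin m) :
    ∑ i, ‖(U : Matrix (Fin m) (Fin m) ℂ) i j‖ ^ 2 = 1 := by
  have h := congrFun (congrFun (Matrix.mem_unitaryGroup_iff'.1 U.2) j) j
  simp only [Matrix.mul_apply, Matrix.star_apply, Matrix.one_apply_eq, RCLike.star_def,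
    Complex.conj_mul'] at h
  exact_mod_cast h

lemma continuous_entry {m : ℕ} (i j : Fin m) :
    Continuous fun U : Matrix.unitaryGroup (Fin m) ℂ => (U : Matrix (Fin m) (Fin m) ℂ) i j :=
  continuous_subtype_val.matrix_elem i j

lemma integrable_of_continuous {m : ℕ} {f : Matrix.unitaryGroup (Fin m) ℂ → ℝ}
    (hf : Continuous f) : Integrable f (haarUnitary m) :=
  hf.integrable_of_hasCompactSupport (HasCompactSupport.of_compactSpace f)

/-- The sum over signs factorizes into a product of `2 * cosh (a l)`, and `cosh x ≤ exp (x ^ 2 /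
2)`. -/
lemma sum_exp_sign_mul_le {ι : Type*} [Fintype ι] [DecidableEq ι] (a : ι → ℝ) :
    ∑ x : ι → Bool, Real.exp (∑ l, (if x l then 1 else -1) * a l) ≤
      2 ^ Fintype.card ι * Real.exp ((∑ l, a l ^ 2) / 2) := by
  simp only [Real.exp_sum]
  rw [← Fintype.prod_sum fun l (b : Bool) => Real.exp ((if b = true then 1 else -1) * a l), Finset.sum_div,
    Real.exp_sum, ← Finset.card_univ, ← Finset.prod_const, ← Finset.prod_mul_distrib]
  refine Finset.prod_le_prod (fun _ _ => by positivity) fun l _ => ?_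
  have := Real.cosh_le_exp_half_sq (a l)
  rw [Real.cosh_eq] at this
  simp only [Fintype.sum_bool, if_true, one_mul, neg_mul, Bool.false_eq_true, if_false]
  linarith

/-- The entries of a Haar-random unitary, rescaled by `√m`, are sub-Gaussian. -/
lemma integral_exp_entry_le {m : ℕ} (i j : Fin m) {c : ℂ} (hc : ‖c‖ = 1) (s : ℝ) :
    ∫ U, Real.exp (s * (√(m : ℝ) * (c * (U : Matrix (Fin m) (Fin m) ℂ) i j).re)) ∂haarUnitary m ≤
      Real.exp (s ^ 2 / 2) := by
  have hm : 0 < (m : ℝ) := by exact_mod_cast i.pos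
  have hx : ∀ x : Fin m → Bool,
      ∫ U, Real.exp (s * (√(m : ℝ) * (c * (U : Matrix (Fin m) (Fin m) ℂ) i j).re)) ∂haarUnitary m =
      ∫ U, Real.exp (∑ l, (if x l then 1 else -1) *
        (s * (c * (U : Matrix (Fin m) (Fin m) ℂ) l j).re)) ∂haarUnitary m := by
    intro x
    -- Left multiplication by `W` replaces the entry by a signed sum of its column, and `1 / √m`
    -- cancels the rescaling.
    obtain ⟨W, hW⟩ := exists_unitary_row_eq i
      (fun l => (((if x l then 1 else -1) / √(m : ℝ) : ℝ) : ℂ)) (by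
        have : ∀ l, ‖(((if x l then 1 else -1) / √(m : ℝ) : ℝ) : ℂ)‖ ^ 2 = 1 / m := fun l => by
          rw [Complex.norm_real, Real.norm_eq_abs, sq_abs, div_pow, Real.sq_sqrt hm.le]
          split_ifs <;> simp
        simp only [this]
        simp [hm.ne'])
    rw [← integral_mul_left_eq_self _ W]
    congr 1 with U
    congr 1
    simp only [Submonoid.coe_mul, Matrix.mul_apply, hW, Finset.mul_sum, Complex.re_sum]
    refine Finset.sum_congr rfl fun l _ => ?_
    rw [mul_left_comm c, Complex.re_ofReal_mul]
    have := (Real.sqrt_pos.2 hm).ne'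
    field_simp
  have hcont : ∀ l : Fin m, Continuous fun U : Matrix.unitaryGroup (Fin m) ℂ =>
      s * (c * (U : Matrix (Fin m) (Fin m) ℂ) l j).re := fun l =>
    continuous_const.mul (Complex.continuous_re.comp (continuous_const.mul (continuous_entry l j)))
  have hint : ∀ x : Fin m → Bool, Integrable (fun U : Matrix.unitaryGroup (Fin m) ℂ =>
      Real.exp (∑ l, (if x l then 1 else -1) *
        (s * (c * (U : Matrix (Fin m) (Fin m) ℂ) l j).re))) (haarUnitary m) := fun x =>
    integrable_of_continuous (Real.continuous_exp.comp
      (continuous_finsetSum _ fun l _ => continuous_const.mul (hcont l)))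
  have hpt : ∀ U : Matrix.unitaryGroup (Fin m) ℂ,
      ∑ x : Fin m → Bool, Real.exp (∑ l, (if x l then 1 else -1) *
        (s * (c * (U : Matrix (Fin m) (Fin m) ℂ) l j).re)) ≤ 2 ^ m * Real.exp (s ^ 2 / 2) := by
    intro U
    refine (sum_exp_sign_mul_le _).trans ?_
    rw [Fintype.card_fin]
    gcongr
    calc _ ≤ ∑ l, s ^ 2 * ‖(U : Matrix (Fin m) (Fin m) ℂ) l j‖ ^ 2 := by
          refine Finset.sum_le_sum fun l _ => ?_
          rw [mul_pow]
          gcongr ?_ * ?_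
          have := Complex.abs_re_le_norm (c * (U : Matrix (Fin m) (Fin m) ℂ) l j)
          rw [norm_mul, hc, one_mul] at this
          exact sq_le_sq' (abs_le.1 this).1 (abs_le.1 this).2
      _ = s ^ 2 := by rw [← Finset.mul_sum, sum_norm_sq_column, mul_one]
  have h2 : (0 : ℝ) < 2 ^ m := by positivity
  refine le_of_mul_le_mul_left ?_ h2
  calc _ = ∑ _x : Fin m → Bool, ∫ U, Real.exp (s * (√(m : ℝ) *
        (c * (U : Matrix (Fin m) (Fin m) ℂ) i j).re)) ∂haarUnitary m := by simp
    _ = ∫ U, ∑ x : Fin m → Bool, Real.exp (∑ l, (if x l then 1 else -1) *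
        (s * (c * (U : Matrix (Fin m) (Fin m) ℂ) l j).re)) ∂haarUnitary m := by
        rw [integral_finsetSum _ fun x _ => hint x]
        exact Finset.sum_congr rfl fun x _ => hx x
    _ ≤ ∫ _U, 2 ^ m * Real.exp (s ^ 2 / 2) ∂haarUnitary m :=
        integral_mono (integrable_finsetSum _ fun x _ => hint x) (integrable_const _) hpt
    _ = _ := by simp

lemma measureReal_re_entry_ge_le {m : ℕ} (i j : Fin m) {c : ℂ} (hc : ‖c‖ = 1) {t : ℝ}
    (ht : 0 ≤ t) :
    (haarUnitary m).real {U | t ≤ √(m : ℝ) * (c * (U : Matrix (Fin m) (Fin m) ℂ) i j).re} ≤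
      Real.exp (-(t ^ 2 / 2)) := by
  -- Chernoff bound at the optimal exponent `s = t`.
  refine (ProbabilityTheory.measure_ge_le_exp_mul_mgf t ht (integrable_of_continuous ?_)).trans ?_
  · exact Real.continuous_exp.comp (continuous_const.mul (continuous_const.mul
      (Complex.continuous_re.comp (continuous_const.mul (continuous_entry i j)))))
  · calc _ ≤ Real.exp (-t * t) * Real.exp (t ^ 2 / 2) := by
          gcongr
          exact integral_exp_entry_le i j hc t
      _ = _ := by rw [← Real.exp_add]; ring_nf

/-- A modulus above `2 * t` forces the real or imaginary part to reach `t` in absolute value: four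
half-planes, `c = ±1, ±I`. -/
lemma measureReal_norm_entry_ge_le {m : ℕ} (i j : Fin m) {t : ℝ} (ht : 0 ≤ t) :
    (haarUnitary m).real {U | 2 * t < √(m : ℝ) * ‖(U : Matrix (Fin m) (Fin m) ℂ) i j‖} ≤
      4 * Real.exp (-(t ^ 2 / 2)) := by
  set S : ℂ → Set (Matrix.unitaryGroup (Fin m) ℂ) := fun c =>
    {U | t ≤ √(m : ℝ) * (c * (U : Matrix (Fin m) (Fin m) ℂ) i j).re} with hS
  have hsub : {U : Matrix.unitaryGroup (Fin m) ℂ |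
      2 * t < √(m : ℝ) * ‖(U : Matrix (Fin m) (Fin m) ℂ) i j‖} ⊆
      (S 1 ∪ S (-1)) ∪ (S Complex.I ∪ S (-Complex.I)) := by
    intro U hU
    by_contra hn
    simp only [hS, Set.mem_union, Set.mem_ofPred_eq, not_or, not_le, one_mul, neg_mul,
      Complex.neg_re, Complex.I_mul_re, neg_neg] at hn
    obtain ⟨⟨h1, h2⟩, h3, h4⟩ := hn
    have h5 := Complex.norm_le_abs_re_add_abs_im ((U : Matrix (Fin m) (Fin m) ℂ) i j)
    have h6 : √(m : ℝ) * |((U : Matrix (Fin m) (Fin m) ℂ) i j).re| < t := by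
      rw [← abs_of_nonneg (Real.sqrt_nonneg (m : ℝ)), ← abs_mul]
      exact abs_lt.2 ⟨by linarith, h1⟩
    have h7 : √(m : ℝ) * |((U : Matrix (Fin m) (Fin m) ℂ) i j).im| < t := by
      rw [← abs_of_nonneg (Real.sqrt_nonneg (m : ℝ)), ← abs_mul]
      exact abs_lt.2 ⟨by linarith, h4⟩
    have h8 := mul_le_mul_of_nonneg_left h5 (Real.sqrt_nonneg (m : ℝ))
    have : 2 * t < √(m : ℝ) * ‖(U : Matrix (Fin m) (Fin m) ℂ) i j‖ := hU
    linarith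
  have hb : ∀ c : ℂ, ‖c‖ = 1 → (haarUnitary m).real (S c) ≤ Real.exp (-(t ^ 2 / 2)) :=
    fun c hc => measureReal_re_entry_ge_le i j hc ht
  have h1 := hb 1 (by simp)
  have h2 := hb (-1) (by simp)
  have h3 := hb Complex.I (by simp)
  have h4 := hb (-Complex.I) (by simp)
  refine (measureReal_mono hsub).trans ((measureReal_union_le _ _).trans ?_)
  have h5 := measureReal_union_le (μ := haarUnitary m) (S 1) (S (-1))
  have h6 := measureReal_union_le (μ := haarUnitary m) (S Complex.I) (S (-Complex.I))
  linarith

/-- The unitaries all of whose entries are at most `ε` in modulus. -/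
def flatUnitaries (m : ℕ) (ε : ℝ) : Set (Matrix.unitaryGroup (Fin m) ℂ) :=
  {U | ∀ i j, ‖(U : Matrix (Fin m) (Fin m) ℂ) i j‖ ≤ ε}

lemma measurableSet_flatUnitaries (m : ℕ) (ε : ℝ) : MeasurableSet (flatUnitaries m ε) := by
  refine IsClosed.measurableSet ?_
  simp only [flatUnitaries, Set.ofPred_forall]
  exact isClosed_iInter fun i => isClosed_iInter fun j =>
    isClosed_le (continuous_entry i j).norm continuous_const

lemma one_sub_le_measureReal_flatUnitaries (m : ℕ) {t : ℝ} (ht : 0 ≤ t) :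
    1 - (m : ℝ) ^ 2 * (4 * Real.exp (-(t ^ 2 / 2))) ≤
      (haarUnitary m).real (flatUnitaries m (2 * t / √(m : ℝ))) := by
  have h : (haarUnitary m).real (flatUnitaries m (2 * t / √(m : ℝ)))ᶜ ≤
      (m : ℝ) ^ 2 * (4 * Real.exp (-(t ^ 2 / 2))) := by
    have hsub : (flatUnitaries m (2 * t / √(m : ℝ)))ᶜ ⊆ ⋃ p : Fin m × Fin m,
        {U | 2 * t < √(m : ℝ) * ‖(U : Matrix (Fin m) (Fin m) ℂ) p.1 p.2‖} := by
      intro U hU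
      simp only [flatUnitaries, Set.mem_compl_iff, Set.mem_ofPred_eq, not_forall, not_le] at hU
      obtain ⟨i, j, hij⟩ := hU
      refine Set.mem_iUnion.2 ⟨(i, j), ?_⟩
      have hm : 0 < (m : ℝ) := by exact_mod_cast i.pos
      rw [div_lt_iff₀' (Real.sqrt_pos.2 hm)] at hij
      exact hij
    refine (measureReal_mono hsub).trans ((measureReal_iUnion_fintype_le _).trans ?_)
    refine (Finset.sum_le_sum fun p _ => measureReal_norm_entry_ge_le p.1 p.2 ht).trans ?_
    simp [sq]
  rw [probReal_compl_eq_one_sub (measurableSet_flatUnitaries m _)] at h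
  linarith

end

end PowerLawBosons

/-! ### Asymptotics and the weakest hop on the lattice -/

namespace PowerLawBosons

section

open Filter Topology

/-- Ensures `δ ≤ 1 / 2` for large `m`. -/
lemma tendsto_const_mul_sqrt_log_div_sqrt (A : ℝ) :
    Tendsto (fun m : ℕ => A * (√(Real.log m) / √(m : ℝ))) atTop (𝓝 0) := by
  have h : Tendsto (fun x : ℝ => Real.log x / x) atTop (𝓝 0) :=
    Real.isLittleO_log_id_atTop.tendsto_div_nhds_zero
  have h2 := ((Real.continuous_sqrt.tendsto 0).comp (h.comp tendsto_natCast_atTop_atTop)).const_mul A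
  rw [Real.sqrt_zero, mul_zero] at h2
  refine h2.congr fun m => ?_
  simp [Function.comp, Real.sqrt_div' _ (Nat.cast_nonneg m)]

lemma one_div_le_one_div_siteDist_rpow {D L : ℕ} (hD : 1 ≤ D) {α : ℝ} (hα : 0 ≤ α) {x y : Site D L}
    (h : x ≠ y) :
    1 / (√(D : ℝ) ^ α * ((L ^ D : ℕ) : ℝ) ^ (α / D)) ≤ 1 / siteDist x y ^ α := by
  have hD' : (D : ℝ) ≠ 0 := by positivity
  refine one_div_le_one_div_of_le (Real.rpow_pos_of_pos (siteDist_pos h) _) ?_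
  calc _ ≤ (√(D : ℝ) * L) ^ α := Real.rpow_le_rpow (siteDist_pos h).le (siteDist_le x y) hα
    _ = _ := by
      rw [Real.mul_rpow (Real.sqrt_nonneg _) (Nat.cast_nonneg _), Nat.cast_pow,
        ← Real.rpow_natCast, ← Real.rpow_mul (Nat.cast_nonneg _), mul_div_cancel₀ _ hD']

end

end PowerLawBosons

/-! ### Assembling the theorem -/

open PowerLawBosons in
theorem mainTheorem3 (D : ℕ) (hD : 1 ≤ D) (α : ℝ) (hα : 0 ≤ α) (k : ℕ) :
    ∃ C : ℝ, 0 < C ∧ ∃ m₀ : ℕ, ∀ (L m n : ℕ) (e : Fin m ≃ PowerLawBosons.Site D L),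
      m₀ ≤ m → n ≤ m →
        ∃ E : Set (Matrix.unitaryGroup (Fin m) ℂ),
          MeasurableSet E ∧
          1 - 1 / (m : ℝ) ^ k ≤ (PowerLawBosons.haarUnitary m).real E ∧
          ∀ U ∈ E, ∀ j : Fin m, (j : ℕ) < n →
            PowerLawBosons.ColumnImplementableWithin α e
              (U : Matrix (Fin m) (Fin m) ℂ) j
              (C * (√(Real.log (m : ℝ)) / (m : ℝ) ^ (1 / 2 - α / (D : ℝ)))) := by
  -- With `t = √(2 * (k + 3) * log m)`, each entry fails with probability at most `4 / m ^ (k + 3)`.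
  -- Over `m ^ 2` entries this totals `(4 / m) / m ^ k`, which explains the requirement `4 ≤ m`.
  set A : ℝ := 2 * √(2 * (k + 3)) with hA
  have hA0 : 0 < A := by positivity
  obtain ⟨m₁, hm₁⟩ := Filter.eventually_atTop.1
    ((tendsto_const_mul_sqrt_log_div_sqrt A).eventually_le_const (by norm_num : (0 : ℝ) < 1 / 2))
  have hB0 : 0 < √(D : ℝ) ^ α := Real.rpow_pos_of_pos (by positivity) _
  refine ⟨Real.pi * A * √(D : ℝ) ^ α, by positivity, max m₁ 4, fun L m n e hm _ => ?_⟩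
  have hm4 : (4 : ℝ) ≤ m := by exact_mod_cast (le_max_right _ _).trans hm
  have hm0 : (0 : ℝ) < m := by linarith
  have hlog : 0 < Real.log m := Real.log_pos (by linarith)
  have hcard : m = L ^ D := by simpa using Fintype.card_congr e
  -- This event controls all `m` columns at once, so it serves every `n`.
  refine ⟨flatUnitaries m (A * (√(Real.log m) / √(m : ℝ))), measurableSet_flatUnitaries _ _, ?_,
    fun U hU j _ => ?_⟩
  · have h := one_sub_le_measureReal_flatUnitaries m (Real.sqrt_nonneg (2 * (k + 3) * Real.log m))
    have hε : 2 * √(2 * (k + 3) * Real.log m) / √(m : ℝ) = A * (√(Real.log m) / √(m : ℝ)) := by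
      rw [Real.sqrt_mul (by positivity), hA]
      ring
    have hexp : Real.exp (-(√(2 * (k + 3) * Real.log m) ^ 2 / 2)) = 1 / (m : ℝ) ^ (k + 3) := by
      rw [Real.sq_sqrt (by positivity), Real.exp_neg, one_div]
      congr 1
      calc _ = Real.exp ((k + 3 : ℕ) * Real.log m) := by push_cast; ring_nf
        _ = _ := by rw [Real.exp_nat_mul, Real.exp_log hm0]
    rw [hε, hexp] at h
    refine le_trans (sub_le_sub_left ?_ 1) h
    calc _ = 4 / m * (1 / (m : ℝ) ^ k) := by field_simp; ring
      _ ≤ 1 * (1 / (m : ℝ) ^ k) := by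
        gcongr
        exact (div_le_one hm0).2 hm4
      _ = _ := one_mul _
  · have h := columnImplementableWithin_of_norm_le (α := α) e
      (U : Matrix (Fin m) (Fin m) ℂ) j (δ := A * (√(Real.log m) / √(m : ℝ)))
      (G := √(D : ℝ) ^ α * (m : ℝ) ^ (α / D)) (by positivity)
      (hm₁ m ((le_max_left _ _).trans hm)) (by positivity)
      (fun i l hil => by
        conv_lhs => rw [hcard]
        exact one_div_le_one_div_siteDist_rpow hD hα (e.injective.ne hil))
      (sum_norm_sq_column U j) (fun i => hU i j)
    convert h using 1
    rw [Real.rpow_sub hm0, ← Real.sqrt_eq_rpow]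
    field_simp
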